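/- A sequence $(u_j)_{j\in\mathbb{N}}$ of real numbers is \emph{uniformly distributed modulo one} if for every interval $I\subseteq[0,1]$, $$\lim_{n\to\infty}\frac{|\{\,j<n : \{u_j\}\in I\,\}|}{n}=\lambda(I),$$ where $\{u\}$ denotes the fractional part of $u$ and $\lambda$ is Lebesgue measure. A real number $x$ is \emph{computable} if there is a computable sequence $(r_n)_{n\in\mathbb{N}}$ of rational numbers with $|x-r_n|\le 2^{-n}$ for every $n$. \textbf{Theorem.} Let $(a^i_j)_{i,j\in\mathbb{N}}$ be a family of integers such that $a^i_j$ is computable from $i$ and $j$ (by a single algorithm) and such that for each $i$ the integers $a^i_0,a^i_1,a^i_2,\dots$ are pairwise distinct. Then there is a computable real number $x\in[0,1]$ such that for every $i\in\mathbb{N}$ the sequence $(a^i_j x)_{j\in\mathbb{N}}$ is uniformly distributed modulo one. -/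

import Mathlib

open scoped Classical in
/-- A sequence `u` of real numbers is uniformly distributed modulo one: for every interval
`I ⊆ [0,1]` (open, closed or half-open, possibly degenerate), the proportion of the indices
`j < n` for which the fractional part of `u j` lies in `I` tends to the Lebesgue measure of `I`. -/
def UniformlyDistributedModOne (u : ℕ → ℝ) : Prop :=
  ∀ I : Set ℝ, I.OrdConnected → I ⊆ Set.Icc 0 1 →
    Filter.Tendsto
      (fun n : ℕ => (((Finset.range n).filter (fun j => Int.fract (u j) ∈ I)).card : ℝ) / (n : ℝ))
      Filter.atTop (nhds (MeasureTheory.volume.real I))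

/-- A real number `x` is computable: there is a computable sequence of rationals `p n / q n`
(given by computable sequences of numerators and nonzero denominators) whose `n`-th term is
within `2⁻ⁿ` of `x`. -/
def IsComputableReal (x : ℝ) : Prop :=
  ∃ (p : ℕ → ℤ) (q : ℕ → ℕ), Computable p ∧ Computable q ∧
    ∀ n : ℕ, q n ≠ 0 ∧ |x - (p n : ℝ) / (q n : ℝ)| ≤ (1 / 2 : ℝ) ^ n

/-! The function 1/6 - {y}(1 - {y}) is the Bernoulli polynomial B₂ at {y}, and equals π⁻² ∑
cos(2πny)/n² over n ≥ 1. Summing it over all differences u_j - u_k of N terms gives π⁻² ∑ |S_n|²/n²,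
where S_n is the n-th Weyl sum (`hasSum_diaphony`). This quantity is nonnegative, and if it is o(N²)
then every Weyl sum is o(N). For u_j = a_j x with distinct integers a_j, the off-diagonal pairs have
integral 0 over x ∈ [0,1], so after division by N² the mean is 1/(6N)
(`integral_unit_stageDiaphony`).

Stage n inspects N = (n+1)² terms of the sequence of index `n.unpair.1`. The means are summable, and
at any x where the normalized diaphonies D_n(x) have a finite sum they tend to 0. For fixed i the
inspected lengths have consecutive ratios tending to 1, so monotonicity of counting fills the gaps
(`uniformlyDistributed_of_tendsto_diaphony`).

A computable such x comes from bisection: at step m keep the half on which the integral of the first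
4^m functions D_n is smaller, up to a small error (`exists_computable_sum_le`). The choice is
effective because {y}(1 - {y}) has a piecewise polynomial primitive with rational coefficients, so
integer scores suffice to compare the halves (`integral_le_of_stageScore_le`). -/

/-! ### Computability of sums, powers and integer differences -/

theorem Computable.nat_sum_range {α : Type*} [Primcodable α] {b : α → ℕ} {f : α → ℕ → ℕ}
    (hb : Computable b) (hf : Computable₂ f) :
    Computable fun x => ∑ j ∈ Finset.range (b x), f x j := by
  have hstep : Computable₂ fun (x : α) (y : ℕ × ℕ) => y.2 + f x y.1 :=
    Primrec.nat_add.to_comp.comp (Computable.snd.comp Computable.snd)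
      (hf.comp Computable.fst (Computable.fst.comp Computable.snd))
  refine (Computable.nat_rec hb (Computable.const 0) hstep).of_eq fun x => ?_
  induction b x with
  | zero => rfl
  | succ n ih => rw [Finset.sum_range_succ, ← ih]

theorem Primrec.nat_pow : Primrec₂ ((· ^ ·) : ℕ → ℕ → ℕ) :=
  Primrec₂.unpaired'.1 Nat.Primrec.pow

theorem Int.encode_natCast (n : ℕ) : Encodable.encode (n : ℤ) = 2 * n := rfl

theorem Int.encode_negSucc (n : ℕ) : Encodable.encode (Int.negSucc n) = 2 * n + 1 := rfl

theorem Primrec.int_natCast : Primrec ((↑) : ℕ → ℤ) :=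
  Primrec.encode_iff.1 ((Primrec.nat_mul.comp (Primrec.const 2) Primrec.id).of_eq fun _ => rfl)

/-- The code of an integer carries the sign in its parity and the size in its half, so the distance
is read off from the codes by natural-number arithmetic; for opposite signs, m - (-(n+1)) = m + n +
1. -/
theorem Int.natAbs_sub_eq_encode (x y : ℤ) :
    (x - y).natAbs =
      if Encodable.encode x % 2 = Encodable.encode y % 2 then
        (Encodable.encode x / 2 - Encodable.encode y / 2) +
          (Encodable.encode y / 2 - Encodable.encode x / 2)
      else Encodable.encode x / 2 + Encodable.encode y / 2 + 1 := by
  rcases x with m | m <;> rcases y with n | n <;>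
    [have hx := Int.encode_natCast m; have hx := Int.encode_natCast m;
      have hx := Int.encode_negSucc m; have hx := Int.encode_negSucc m] <;>
    [have hy := Int.encode_natCast n; have hy := Int.encode_negSucc n;
      have hy := Int.encode_natCast n; have hy := Int.encode_negSucc n] <;>
    (try simp only [Int.ofNat_eq_natCast] at *) <;> split_ifs <;> omega

theorem Primrec.int_natAbs_sub : Primrec₂ fun x y : ℤ => (x - y).natAbs := by
  have hx : Primrec fun z : ℤ × ℤ => Encodable.encode z.1 := Primrec.encode.comp Primrec.fst
  have hy : Primrec fun z : ℤ × ℤ => Encodable.encode z.2 := Primrec.encode.comp Primrec.snd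
  have hx2 := Primrec.nat_div.comp hx (Primrec.const 2)
  have hy2 := Primrec.nat_div.comp hy (Primrec.const 2)
  have h : Primrec fun z : ℤ × ℤ => (z.1 - z.2).natAbs := by
    refine (Primrec.ite (Primrec.eq.comp (Primrec.nat_mod.comp hx (Primrec.const 2))
      (Primrec.nat_mod.comp hy (Primrec.const 2)))
      (Primrec.nat_add.comp (Primrec.nat_sub.comp hx2 hy2) (Primrec.nat_sub.comp hy2 hx2))
      (Primrec.succ.comp (Primrec.nat_add.comp hx2 hy2))).of_eq fun z => ?_
    exact (Int.natAbs_sub_eq_encode z.1 z.2).symm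
  exact h

/-! ### The periodic parabola, its primitive and its Fourier series -/

/-- The `1`-periodic function `y ↦ {y} (1 - {y})`. -/
noncomputable def fractParabola (y : ℝ) : ℝ := Int.fract y * (1 - Int.fract y)

/-- The primitive of `fractParabola` vanishing at `0`. -/
noncomputable def fractParabolaInt (y : ℝ) : ℝ :=
  ⌊y⌋ / 6 + Int.fract y ^ 2 / 2 - Int.fract y ^ 3 / 3

theorem fractParabola_nonneg (y : ℝ) : 0 ≤ fractParabola y :=
  mul_nonneg (Int.fract_nonneg y) (by linarith [Int.fract_lt_one y])

theorem fractParabola_zero : fractParabola 0 = 0 := by simp [fractParabola]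

theorem fractParabola_neg (y : ℝ) : fractParabola (-y) = fractParabola y := by
  by_cases h : Int.fract y = 0
  · simp [fractParabola, h, Int.fract_neg_eq_zero.2 h]
  · rw [fractParabola, fractParabola, Int.fract_neg h]; ring

theorem fractParabola_intCast_mul (z : ℤ) (x : ℝ) :
    fractParabola (z * x) = fractParabola (z.natAbs * x) := by
  rcases Int.natAbs_eq z with h | h
  · conv_lhs => rw [h]
    simp
  · conv_lhs => rw [h]
    rw [← fractParabola_neg]; simp

theorem fractParabola_continuous : Continuous fractParabola := by
  refine ContinuousOn.comp_fract'' (f := fun t : ℝ => t * (1 - t)) (by fun_prop) (by simp)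

theorem fractParabola_periodic : Function.Periodic fractParabola 1 := fun y => by
  simp [fractParabola]

theorem integral_fractParabola_of_mem {y : ℝ} (h0 : 0 ≤ y) (h1 : y ≤ 1) :
    ∫ s in (0 : ℝ)..y, fractParabola s = y ^ 2 / 2 - y ^ 3 / 3 := by
  have h : ∫ s in (0 : ℝ)..y, fractParabola s = ∫ s in (0 : ℝ)..y, (s - s ^ 2) := by
    refine intervalIntegral.integral_congr fun s hs => ?_
    rw [Set.uIcc_of_le h0] at hs
    rcases (hs.2.trans h1).lt_or_eq with hlt | rfl
    · simp only [fractParabola, Int.fract_eq_self.2 ⟨hs.1, hlt⟩]; ring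
    · simp [fractParabola]
  rw [h, intervalIntegral.integral_sub (by simp) (by simp)]
  simp; norm_num

theorem integral_zero_fractParabola (y : ℝ) :
    ∫ s in (0 : ℝ)..y, fractParabola s = fractParabolaInt y := by
  have hi : ∀ a b, IntervalIntegrable fractParabola MeasureTheory.volume a b :=
    fun a b => fractParabola_continuous.intervalIntegrable a b
  have h1 := fractParabola_periodic.intervalIntegral_add_zsmul_eq ⌊y⌋ 0
  simp only [zero_add, zsmul_eq_mul, mul_one] at h1
  replace h1 := h1 hi
  rw [integral_fractParabola_of_mem zero_le_one le_rfl] at h1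
  have h2 : ∫ s in (⌊y⌋ : ℝ)..y, fractParabola s = ∫ s in (0 : ℝ)..Int.fract y, fractParabola s := by
    have h3 := intervalIntegral.integral_comp_add_right (a := 0) (b := Int.fract y)
      fractParabola (⌊y⌋ : ℝ)
    rw [zero_add, Int.fract_add_floor] at h3
    rw [← h3]
    refine intervalIntegral.integral_congr fun s _ => ?_
    simp [fractParabola]
  rw [← intervalIntegral.integral_add_adjacent_intervals (hi 0 ⌊y⌋) (hi ⌊y⌋ y), h1, h2,
    integral_fractParabola_of_mem (Int.fract_nonneg y) (Int.fract_lt_one y).le, fractParabolaInt]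
  ring

theorem integral_fractParabola_mul (c : ℝ) (a b : ℝ) :
    c * ∫ x in a..b, fractParabola (c * x) = fractParabolaInt (c * b) - fractParabolaInt (c * a) := by
  rw [intervalIntegral.mul_integral_comp_mul_left, ← integral_zero_fractParabola,
    ← integral_zero_fractParabola, intervalIntegral.integral_interval_sub_left] <;>
  exact fractParabola_continuous.intervalIntegrable _ _

theorem integral_unit_fractParabola_mul {c : ℕ} (hc : c ≠ 0) :
    ∫ x in (0 : ℝ)..1, fractParabola (c * x) = 1 / 6 := by
  have h := integral_fractParabola_mul c 0 1
  have hc' : (c : ℝ) ≠ 0 := by exact_mod_cast hc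
  rw [mul_one, mul_zero] at h
  rw [← mul_right_inj' hc', h]
  simp [fractParabolaInt]; ring

/-- Fourier expansion of B₂ at {y}. The term n = 0 is harmless, since 1 / 0 = 0. -/
theorem hasSum_cos_fractParabola (y : ℝ) :
    HasSum (fun n : ℕ => 1 / (n : ℝ) ^ 2 * Real.cos (2 * Real.pi * n * y))
      (Real.pi ^ 2 * (1 / 6 - fractParabola y)) := by
  have h := hasSum_one_div_nat_pow_mul_cos (k := 1) one_ne_zero
    (x := Int.fract y) ⟨Int.fract_nonneg y, (Int.fract_lt_one y).le⟩
  have hb := bernoulliFun_two (Int.fract y)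
  rw [bernoulliFun] at hb
  convert h using 1
  · funext n
    congr 1
    have : 2 * Real.pi * n * y = 2 * Real.pi * n * Int.fract y + (n * ⌊y⌋ : ℤ) * (2 * Real.pi) := by
      rw [Int.fract]; push_cast; ring
    rw [this, Real.cos_add_int_mul_two_pi]
  · simp only [Nat.mul_one]
    first
      | rw [Polynomial.eval_map_algebraMap, hb]
      | rw [hb]
    rw [fractParabola]; simp [Nat.factorial]; ring

/-- Integer version of `fractParabolaInt`: its value at `s / T`, scaled by `6 T ^ 3`. -/
def parabolaNat (T s : ℕ) : ℕ := T ^ 3 * (s / T) + (3 * (s % T) ^ 2 * T - 2 * (s % T) ^ 3)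

theorem parabolaNat_cast {T : ℕ} (hT : T ≠ 0) (s : ℕ) :
    (parabolaNat T s : ℝ) = 6 * (T : ℝ) ^ 3 * fractParabolaInt (s / T) := by
  have hT' : (T : ℝ) ≠ 0 := by exact_mod_cast hT
  -- The natural subtraction in `parabolaNat` does not truncate.
  have hle : 2 * (s % T) ^ 3 ≤ 3 * (s % T) ^ 2 * T := by
    have := (Nat.mod_lt s (Nat.pos_of_ne_zero hT)).le
    calc 2 * (s % T) ^ 3 = 2 * (s % T) ^ 2 * (s % T) := by ring
      _ ≤ 3 * (s % T) ^ 2 * T := by gcongr; norm_num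
  have hfl : ⌊(s : ℝ) / T⌋ = ((s / T : ℕ) : ℤ) := by
    rw [← Int.natCast_floor_eq_floor (by positivity), Nat.floor_div_eq_div]
  have hfr : Int.fract ((s : ℝ) / T) = ((s % T : ℕ) : ℝ) / T := by
    rw [Int.fract, hfl, eq_div_iff hT', sub_mul, div_mul_cancel₀ _ hT', sub_eq_iff_eq_add]
    norm_cast
    exact_mod_cast (Nat.mod_add_div' s T).symm
  rw [parabolaNat, fractParabolaInt, hfl, hfr, Int.cast_natCast]
  rw [Nat.cast_add, Nat.cast_sub hle]
  simp only [Nat.cast_mul, Nat.cast_pow, Nat.cast_ofNat]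
  field_simp
  ring

/-! ### Weyl's criterion on the circle -/

-- Translation by 1/(2n) preserves the measure and changes the sign of the character.
open Filter MeasureTheory in
theorem UnitAddCircle.integral_fourier {n : ℤ} (hn : n ≠ 0) :
    ∫ z : UnitAddCircle, fourier n z = 0 := by
  have h := integral_add_right_eq_self (μ := (volume : Measure UnitAddCircle))
    (fun z => fourier n z) (((1 : ℝ) / 2 / n : ℝ) : UnitAddCircle)
  simp only [fourier_add_half_inv_index hn one_pos] at h
  rw [integral_neg] at h
  exact self_eq_neg.1 h.symm

/-- The empirical measure on the circle of the first `N + 1` terms of a sequence. -/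
noncomputable def circleEmpirical (u : ℕ → UnitAddCircle) (N : ℕ) :
    MeasureTheory.ProbabilityMeasure UnitAddCircle :=
  ⟨((N : ENNReal) + 1)⁻¹ • ∑ j ∈ Finset.range (N + 1), MeasureTheory.Measure.dirac (u j), ⟨by
    simp [ENNReal.inv_mul_cancel]⟩⟩

theorem integral_circleEmpirical (u : ℕ → UnitAddCircle) (N : ℕ) {E : Type*}
    [NormedAddCommGroup E] [NormedSpace ℝ E] [CompleteSpace E] (f : C(UnitAddCircle, E)) :
    ∫ z, f z ∂(circleEmpirical u N : MeasureTheory.Measure UnitAddCircle) =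
      ((N : ℝ) + 1)⁻¹ • ∑ j ∈ Finset.range (N + 1), f (u j) := by
  rw [circleEmpirical, MeasureTheory.ProbabilityMeasure.coe_mk, MeasureTheory.integral_smul_measure,
    MeasureTheory.integral_finsetSum_measure]
  · simp [ENNReal.toReal_add]
  · intro j _
    exact MeasureTheory.integrable_dirac (by simp [enorm_lt_top])

theorem norm_integral_circle_le (μ : MeasureTheory.ProbabilityMeasure UnitAddCircle)
    (f : C(UnitAddCircle, ℂ)) : ‖∫ z, f z ∂(μ : MeasureTheory.Measure UnitAddCircle)‖ ≤ ‖f‖ := by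
  simpa using MeasureTheory.norm_integral_le_of_norm_le_const
    (μ := (μ : MeasureTheory.Measure UnitAddCircle)) (Filter.Eventually.of_forall f.norm_coe_le_norm)

open Filter MeasureTheory in
/-- **Weyl's criterion** for weak convergence to the Haar measure of the circle. -/
theorem tendsto_circle_of_tendsto_integral_fourier {μ : ℕ → ProbabilityMeasure UnitAddCircle}
    (ν : ProbabilityMeasure UnitAddCircle) (hν : (ν : Measure UnitAddCircle) = volume)
    (h : ∀ n : ℕ, n ≠ 0 → Tendsto
      (fun k => ∫ z, fourier (n : ℤ) z ∂(μ k : Measure UnitAddCircle)) atTop (nhds 0)) :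
    Tendsto μ atTop (nhds ν) := by
  have hint : ∀ (m : ProbabilityMeasure UnitAddCircle) (f : C(UnitAddCircle, ℂ)),
      Integrable f (m : Measure UnitAddCircle) := fun m f =>
    f.continuous.integrable_of_hasCompactSupport (HasCompactSupport.of_compactSpace f)
  have hfour : ∀ n : ℤ, Tendsto (fun k => ∫ z, fourier n z ∂(μ k : Measure UnitAddCircle)) atTop
      (nhds (∫ z, fourier n z ∂(ν : Measure UnitAddCircle))) := by
    intro n
    rcases eq_or_ne n 0 with rfl | hn
    · simp
    · rw [hν, UnitAddCircle.integral_fourier hn]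
      obtain ⟨m, rfl | rfl⟩ := n.eq_nat_or_neg
      · exact h m (by simpa using hn)
      -- Negative frequencies are conjugates of positive ones.
      · have h1 := (Complex.continuous_conj.tendsto 0).comp (h m (by simpa using hn))
        rw [map_zero] at h1
        refine h1.congr fun k => ?_
        simp only [Function.comp_apply, ← integral_conj, fourier_neg]
  have hspan : ∀ f ∈ Submodule.span ℂ (Set.range (fourier : ℤ → C(UnitAddCircle, ℂ))),
      Tendsto (fun k => ∫ z, f z ∂(μ k : Measure UnitAddCircle)) atTop
        (nhds (∫ z, f z ∂(ν : Measure UnitAddCircle))) := by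
    intro f hf
    induction hf using Submodule.span_induction with
    | mem f hf => obtain ⟨n, rfl⟩ := hf; exact hfour n
    | zero => simp
    | add f g _ _ hf hg =>
      simp only [ContinuousMap.add_apply, integral_add (hint _ f) (hint _ g)]
      exact hf.add hg
    | smul c f _ hf =>
      simp only [ContinuousMap.smul_apply, integral_smul]
      exact hf.const_smul c
  refine (ProbabilityMeasure.tendsto_iff_forall_integral_rclike_tendsto ℂ).2 fun f => ?_
  refine Metric.tendsto_atTop.2 fun ε hε => ?_
  have hmem : f.toContinuousMap ∈
      (Submodule.span ℂ (Set.range (fourier : ℤ → C(UnitAddCircle, ℂ)))).topologicalClosure := by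
    rw [span_fourier_closure_eq_top]; trivial
  obtain ⟨g, hg, hfg⟩ := Metric.mem_closure_iff.1 hmem (ε / 3) (by positivity)
  obtain ⟨K, hK⟩ := Metric.tendsto_atTop.1 (hspan g hg) (ε / 3) (by positivity)
  refine ⟨K, fun k hk => ?_⟩
  have hdist : ∀ m : ProbabilityMeasure UnitAddCircle,
      dist (∫ z, f z ∂(m : Measure UnitAddCircle)) (∫ z, g z ∂(m : Measure UnitAddCircle))
        < ε / 3 := by
    intro m
    have h1 := norm_integral_circle_le m (f.toContinuousMap - g)
    simp only [ContinuousMap.sub_apply] at h1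
    rw [integral_sub (hint m f.toContinuousMap) (hint m g), ← dist_eq_norm, ← dist_eq_norm] at h1
    exact h1.trans_lt hfg
  have h2 := hdist (μ k)
  have h3 := hdist ν
  have h4 := hK k hk
  rw [dist_comm] at h3
  calc dist (∫ z, f z ∂(μ k : Measure UnitAddCircle)) (∫ z, f z ∂(ν : Measure UnitAddCircle))
      ≤ _ + _ + _ := dist_triangle4 _ _ _ _
    _ < ε := by linarith

/-! ### From the circle back to intervals -/

/-- The representative in `[0, 1)` of a point of the circle. -/
noncomputable def circleFract (z : UnitAddCircle) : ℝ := AddCircle.measurableEquivIco 1 0 z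

theorem circleFract_coe (t : ℝ) : circleFract t = Int.fract t := by
  have h := AddCircle.coe_equivIco_mk_apply (1 : ℝ) t
  rw [mul_one, div_one] at h
  exact h

theorem measurable_circleFract : Measurable circleFract :=
  measurable_subtype_coe.comp (AddCircle.measurableEquivIco 1 0).measurable

open MeasureTheory in
theorem volume_circleFract_preimage {S : Set ℝ} (hS : MeasurableSet S) :
    volume (circleFract ⁻¹' S) = volume (S ∩ Set.Ioo 0 1) := by
  rw [AddCircle.add_projection_respects_measure 1 0 (measurable_circleFract hS), zero_add,
    ← measure_congr ((ae_eq_refl _).inter Ioo_ae_eq_Ioc)]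
  congr 1
  ext t
  refine and_congr_left fun ht => ?_
  change circleFract (t : UnitAddCircle) ∈ S ↔ t ∈ S
  rw [circleFract_coe, Int.fract_eq_self.2 ⟨ht.1.le, ht.2⟩]

open MeasureTheory in
theorem volume_frontier_circleFract_preimage {I : Set ℝ} (hI : I.OrdConnected) :
    volume (frontier (circleFract ⁻¹' I)) = 0 := by
  -- The point 0 is added because `circleFract` jumps there; elsewhere it is locally inverse to the
  -- projection.
  have hsub : frontier (circleFract ⁻¹' I) ⊆ circleFract ⁻¹' (frontier I ∪ {0}) := by
    intro z
    obtain ⟨t, ht, rfl⟩ : ∃ t ∈ Set.Ico (0 : ℝ) 1, (t : UnitAddCircle) = z := by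
      obtain ⟨t, rfl⟩ := QuotientAddGroup.mk_surjective z
      refine ⟨Int.fract t, ⟨Int.fract_nonneg t, Int.fract_lt_one t⟩, ?_⟩
      rw [Int.fract, AddCircle.coe_sub, sub_eq_self, AddCircle.coe_eq_zero_iff]
      exact ⟨⌊t⌋, by simp⟩
    contrapose!
    intro hz
    simp only [Set.mem_preimage, circleFract_coe, Int.fract_eq_self.2 ht, Set.mem_union,
      Set.mem_singleton_iff, not_or] at hz
    have ht' : t ∈ Set.Ioo (0 : ℝ) 1 := ⟨lt_of_le_of_ne ht.1 (Ne.symm hz.2), ht.2⟩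
    have key : ∀ J : Set ℝ, t ∈ interior J →
        (t : UnitAddCircle) ∈ interior (circleFract ⁻¹' J) := by
      intro J hJ
      refine mem_interior.2 ⟨((↑) : ℝ → UnitAddCircle) '' (interior J ∩ Set.Ioo 0 1), ?_,
        QuotientAddGroup.isOpenMap_coe _ (isOpen_interior.inter isOpen_Ioo), ⟨t, ⟨hJ, ht'⟩, rfl⟩⟩
      rintro _ ⟨s, ⟨hs, hs'⟩, rfl⟩
      rw [Set.mem_preimage, circleFract_coe, Int.fract_eq_self.2 ⟨hs'.1.le, hs'.2⟩]
      exact interior_subset hs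
    by_cases htI : t ∈ I
    · exact Set.disjoint_left.1 disjoint_interior_frontier
        (key I (by_contra fun h => hz.1 ⟨subset_closure htI, h⟩))
    · rw [← frontier_compl, ← Set.preimage_compl]
      rw [← frontier_compl] at hz
      exact Set.disjoint_left.1 disjoint_interior_frontier
        (key Iᶜ (by_contra fun h => hz.1 ⟨subset_closure htI, h⟩))
  refine measure_mono_null hsub ?_
  rw [volume_circleFract_preimage (isClosed_frontier.measurableSet.union (by simp))]
  refine measure_mono_null Set.inter_subset_left ?_
  rw [measure_union_null_iff]
  exact ⟨hI.convex.addHaar_frontier volume, by simp⟩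

open scoped Classical in
open Filter MeasureTheory in
theorem tendsto_count_of_tendsto_fourier (u : ℕ → ℝ) (c : ℕ → ℕ)
    (h : ∀ n : ℕ, n ≠ 0 → Tendsto (fun k => ((c k : ℝ) + 1)⁻¹ •
      ∑ j ∈ Finset.range (c k + 1), fourier (n : ℤ) (u j : UnitAddCircle)) atTop (nhds 0))
    {I : Set ℝ} (hI : I.OrdConnected) (hI01 : I ⊆ Set.Icc 0 1) :
    Tendsto (fun k => (((Finset.range (c k + 1)).filter (fun j => Int.fract (u j) ∈ I)).card : ℝ) /
      ((c k + 1 : ℕ) : ℝ)) atTop (nhds (volume.real I)) := by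
  have hweak := tendsto_circle_of_tendsto_integral_fourier
    (μ := fun k => circleEmpirical (fun j => (u j : UnitAddCircle)) (c k))
    ⟨volume, ⟨UnitAddCircle.measure_univ⟩⟩ rfl (fun n hn => by
      simpa only [integral_circleEmpirical] using h n hn)
  have hmI : MeasurableSet I := hI.measurableSet
  have h1 := ProbabilityMeasure.tendsto_measure_of_null_frontier_of_tendsto' hweak
    (E := circleFract ⁻¹' I) (volume_frontier_circleFract_preimage hI)
  have hvol : volume (circleFract ⁻¹' I) = volume I := by
    rw [volume_circleFract_preimage hmI, measure_congr ((ae_eq_refl I).inter Ioo_ae_eq_Icc),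
      Set.inter_eq_left.2 hI01]
  rw [ProbabilityMeasure.coe_mk, hvol] at h1
  have hfin : volume I ≠ ⊤ := ((measure_mono hI01).trans_lt measure_Icc_lt_top).ne
  have h2 := (ENNReal.tendsto_toReal hfin).comp h1
  refine h2.congr fun k => ?_
  simp [circleEmpirical, Measure.smul_apply, Measure.finsetSum_apply,
    Measure.dirac_apply' _ (measurable_circleFract hmI), Set.indicator_apply, circleFract_coe]
  rw [ENNReal.toReal_add (by simp) (by simp), ENNReal.toReal_natCast, ENNReal.toReal_one]
  exact inv_mul_eq_div _ _

/-! ### Diaphony and uniform distribution -/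

/-- The (unnormalized) squared diaphony of the first `N` terms of a sequence. -/
noncomputable def diaphony (u : ℕ → ℝ) (N : ℕ) : ℝ :=
  ∑ j ∈ Finset.range N, ∑ k ∈ Finset.range N, (1 / 6 - fractParabola (u j - u k))

theorem norm_sq_sum_fourier (u : ℕ → ℝ) (N n : ℕ) :
    ‖∑ j ∈ Finset.range N, fourier (n : ℤ) (u j : UnitAddCircle)‖ ^ 2 =
      ∑ j ∈ Finset.range N, ∑ k ∈ Finset.range N, Real.cos (2 * Real.pi * n * (u j - u k)) := by
  have hf : ∀ j, fourier (n : ℤ) (u j : UnitAddCircle) =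
      Complex.exp ((2 * Real.pi * n * u j : ℝ) * Complex.I) := by
    intro j
    rw [fourier_coe_apply]
    congr 1
    push_cast
    ring
  rw [← Complex.normSq_eq_norm_sq, Complex.normSq_apply, Complex.re_sum, Complex.im_sum]
  simp only [hf, Complex.exp_ofReal_mul_I_re, Complex.exp_ofReal_mul_I_im, Finset.sum_mul_sum,
    ← Finset.sum_add_distrib, mul_sub, Real.cos_sub]

theorem hasSum_diaphony (u : ℕ → ℝ) (N : ℕ) :
    HasSum (fun n : ℕ => 1 / (n : ℝ) ^ 2 *
      ‖∑ j ∈ Finset.range N, fourier (n : ℤ) (u j : UnitAddCircle)‖ ^ 2)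
      (Real.pi ^ 2 * diaphony u N) := by
  simp only [norm_sq_sum_fourier, diaphony, Finset.mul_sum]
  exact hasSum_sum fun j _ => hasSum_sum fun k _ => hasSum_cos_fractParabola (u j - u k)

theorem diaphony_nonneg (u : ℕ → ℝ) (N : ℕ) : 0 ≤ diaphony u N := by
  have h := (hasSum_diaphony u N).nonneg fun n => by positivity
  have hpi : 0 < Real.pi ^ 2 := by positivity
  exact nonneg_of_mul_nonneg_right h hpi

/-- A single term of the nonnegative series `hasSum_diaphony` is at most its sum. -/
theorem norm_sum_fourier_sq_le (u : ℕ → ℝ) (N : ℕ) {n : ℕ} (hn : n ≠ 0) :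
    ‖∑ j ∈ Finset.range N, fourier (n : ℤ) (u j : UnitAddCircle)‖ ^ 2 ≤
      (n : ℝ) ^ 2 * (Real.pi ^ 2 * diaphony u N) := by
  have h := le_hasSum (hasSum_diaphony u N) n fun m _ => by positivity
  have hn' : 0 < (n : ℝ) ^ 2 := by positivity
  rwa [one_div_mul_eq_div, div_le_iff₀' hn'] at h

open Filter in
theorem tendsto_fourier_of_tendsto_diaphony (u : ℕ → ℝ) (c : ℕ → ℕ)
    (h : Tendsto (fun k => diaphony u (c k + 1) / ((c k : ℝ) + 1) ^ 2) atTop (nhds 0))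
    {n : ℕ} (hn : n ≠ 0) :
    Tendsto (fun k => ((c k : ℝ) + 1)⁻¹ •
      ∑ j ∈ Finset.range (c k + 1), fourier (n : ℤ) (u j : UnitAddCircle)) atTop (nhds 0) := by
  rw [tendsto_zero_iff_norm_tendsto_zero]
  have h1 := ((h.const_mul ((n : ℝ) ^ 2 * Real.pi ^ 2)).sqrt)
  rw [mul_zero, Real.sqrt_zero] at h1
  refine squeeze_zero (fun k => norm_nonneg _) (fun k => ?_) h1
  refine Real.le_sqrt_of_sq_le ?_
  have hpos : (0 : ℝ) < (c k : ℝ) + 1 := by positivity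
  rw [norm_smul, mul_pow, norm_inv, Real.norm_of_nonneg hpos.le, inv_pow, inv_mul_eq_div,
    ← mul_div_assoc]
  gcongr
  rw [mul_assoc]
  exact norm_sum_fourier_sq_le u _ hn

open scoped Classical in
open Filter in
theorem uniformlyDistributed_of_tendsto_diaphony (u : ℕ → ℝ) (c : ℕ → ℕ)
    (hc : Tendsto c atTop atTop)
    (hratio : Tendsto (fun k => ((c (k + 1) + 1 : ℕ) : ℝ) / ((c k + 1 : ℕ) : ℝ)) atTop (nhds 1))
    (h : Tendsto (fun k => diaphony u (c k + 1) / ((c k : ℝ) + 1) ^ 2) atTop (nhds 0)) :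
    UniformlyDistributedModOne u := by
  intro I hI hI01
  have hcount := tendsto_count_of_tendsto_fourier u c
    (fun n hn => tendsto_fourier_of_tendsto_diaphony u c h hn) hI hI01
  -- Between two consecutive inspected lengths the count is monotone, and the lengths differ by a
  -- factor tending to 1, so the limit along them is the full limit.
  refine tendsto_div_of_monotone_of_exists_subseq_tendsto_div
    (fun n => (((Finset.range n).filter (fun j => Int.fract (u j) ∈ I)).card : ℝ)) _ ?_ ?_
  · intro m n hmn
    simp only [Nat.cast_le]
    gcongr
  · intro a ha
    refine ⟨fun k => c k + 1, ?_, tendsto_atTop_mono (fun k => Nat.le_succ _) hc, hcount⟩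
    filter_upwards [hratio.eventually_lt_const ha] with k hk
    rw [div_lt_iff₀ (by positivity)] at hk
    exact hk.le

/-! ### Effective choice of a point by bisection -/

/-- Digits of a real number by bisection: the binary interval `p` is replaced by whichever half has
the larger score. -/
def bisect (R : ℕ → ℕ → ℕ) : ℕ → ℕ
  | 0 => 0
  | m + 1 =>
    if R m (2 * bisect R m + 1) ≤ R m (2 * bisect R m) then 2 * bisect R m else 2 * bisect R m + 1

theorem computable_bisect {R : ℕ → ℕ → ℕ} (hR : Computable₂ R) : Computable (bisect R) := by
  have hp : Computable fun z : ℕ × ℕ × ℕ => 2 * z.2.2 :=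
    Primrec.nat_mul.to_comp.comp (Computable.const 2) (Computable.snd.comp Computable.snd)
  have hp' : Computable fun z : ℕ × ℕ × ℕ => 2 * z.2.2 + 1 := Computable.succ.comp hp
  have hm : Computable fun z : ℕ × ℕ × ℕ => z.2.1 := Computable.fst.comp Computable.snd
  have hle : Computable fun z : ℕ × ℕ => decide (z.1 ≤ z.2) := Primrec.nat_le.decide.to_comp
  have hc : Computable fun z : ℕ × ℕ × ℕ => decide (R z.2.1 (2 * z.2.2 + 1) ≤ R z.2.1 (2 * z.2.2)) :=
    hle.comp ((hR.comp hm hp').pair (hR.comp hm hp))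
  have hstep : Computable₂ fun (_ : ℕ) (y : ℕ × ℕ) =>
      bif decide (R y.1 (2 * y.2 + 1) ≤ R y.1 (2 * y.2)) then 2 * y.2 else 2 * y.2 + 1 :=
    Computable.cond hc hp hp'
  refine (Computable.nat_rec Computable.id (Computable.const 0) hstep).of_eq fun m => ?_
  induction m with
  | zero => rfl
  | succ m ih =>
    simp only [id_eq] at ih ⊢
    rw [ih, bisect, Bool.cond_decide]

theorem bisect_succ_eq (R : ℕ → ℕ → ℕ) (m : ℕ) :
    bisect R (m + 1) = 2 * bisect R m ∨ bisect R (m + 1) = 2 * bisect R m + 1 := by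
  rw [bisect]; split_ifs <;> simp

theorem bisect_lower_mono (R : ℕ → ℕ → ℕ) : Monotone fun m => (bisect R m : ℝ) / 2 ^ m := by
  refine monotone_nat_of_le_succ fun m => ?_
  rw [div_le_div_iff₀ (by positivity) (by positivity), pow_succ]
  have h2 : (0 : ℝ) < 2 ^ m := by positivity
  rcases bisect_succ_eq R m with h | h <;> rw [h] <;> push_cast <;> nlinarith

theorem bisect_upper_anti (R : ℕ → ℕ → ℕ) : Antitone fun m => ((bisect R m : ℝ) + 1) / 2 ^ m := by
  refine antitone_nat_of_succ_le fun m => ?_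
  rw [div_le_div_iff₀ (by positivity) (by positivity), pow_succ]
  have h2 : (0 : ℝ) < 2 ^ m := by positivity
  rcases bisect_succ_eq R m with h | h <;> rw [h] <;> push_cast <;> nlinarith

-- The left side is the mean over the current interval. Passing to the chosen half costs at most 2^m
-- / 4^m = 1/2^m. The functions that enter are bounded crudely by their integrals over [0,1], and
-- cost at most 2^(m+1) · (1/2) / 4^m = 1/2^m. Together this is 2/2^m = 4/2^m - 4/2^(m+1).
open MeasureTheory in
theorem integral_bisect_le {D : ℕ → ℝ → ℝ} (hcont : ∀ n, Continuous (D n)) (hpos : ∀ n x, 0 ≤ D n x)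
    (hint : ∀ n, ∫ x in (0 : ℝ)..1, D n x ≤ 1 / (6 * ((n : ℝ) + 1) ^ 2)) {R : ℕ → ℕ → ℕ}
    (hscore : ∀ m p q, R m q ≤ R m p →
      ∫ x in ((p : ℝ) / 2 ^ (m + 1))..((p + 1) / 2 ^ (m + 1)), ∑ n ∈ Finset.range (4 ^ m), D n x ≤
      (∫ x in ((q : ℝ) / 2 ^ (m + 1))..((q + 1) / 2 ^ (m + 1)), ∑ n ∈ Finset.range (4 ^ m), D n x)
        + 1 / 4 ^ m) (m : ℕ) :
    2 ^ m * ∫ x in ((bisect R m : ℝ) / 2 ^ m)..((bisect R m + 1) / 2 ^ m),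
      ∑ n ∈ Finset.range (4 ^ m), D n x ≤ 5 - 4 / 2 ^ m := by
  have hFc : ∀ K, Continuous fun x => ∑ n ∈ Finset.range K, D n x := fun K =>
    continuous_finsetSum _ fun n _ => hcont n
  induction m with
  | zero =>
    have := hint 0
    norm_num [bisect] at this ⊢
    linarith
  | succ m ih =>
    set p := bisect R m with hp
    set r := bisect R (m + 1) with hr
    set F : ℝ → ℝ := fun x => ∑ n ∈ Finset.range (4 ^ m), D n x with hF
    have hFi : ∀ a b, IntervalIntegrable F volume a b := fun a b =>
      (hFc (4 ^ m)).intervalIntegrable a b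
    have h2 : (0 : ℝ) < 2 ^ m := by positivity
    -- the chosen half
    have hhalf : 2 * ∫ x in ((r : ℝ) / 2 ^ (m + 1))..((r + 1) / 2 ^ (m + 1)), F x ≤
        (∫ x in ((p : ℝ) / 2 ^ m)..((p + 1) / 2 ^ m), F x) + 1 / 4 ^ m := by
      have hsplit := intervalIntegral.integral_add_adjacent_intervals
        (hFi (((2 * p : ℕ) : ℝ) / 2 ^ (m + 1)) (((2 * p : ℕ) + 1 : ℝ) / 2 ^ (m + 1)))
        (hFi (((2 * p : ℕ) + 1 : ℝ) / 2 ^ (m + 1)) (((2 * p + 1 : ℕ) + 1 : ℝ) / 2 ^ (m + 1)))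
      have e1 : ((2 * p : ℕ) : ℝ) / 2 ^ (m + 1) = (p : ℝ) / 2 ^ m := by
        push_cast; field_simp; ring
      have e2 : ((2 * p + 1 : ℕ) + 1 : ℝ) / 2 ^ (m + 1) = ((p : ℝ) + 1) / 2 ^ m := by
        push_cast; field_simp; ring
      have e3 : ((2 * p : ℕ) + 1 : ℝ) / 2 ^ (m + 1) = ((2 * p + 1 : ℕ) : ℝ) / 2 ^ (m + 1) := by
        push_cast; ring
      rw [e1, e2] at hsplit
      by_cases hle : R m (2 * p + 1) ≤ R m (2 * p)
      · have hrp : r = 2 * p := by rw [hr, bisect, if_pos hle]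
        have := hscore m _ _ hle
        rw [e2, ← e3, e1] at this
        rw [hrp, e1]
        linarith
      · have hrp : r = 2 * p + 1 := by rw [hr, bisect, if_neg hle]
        have := hscore m _ _ (not_le.1 hle).le
        rw [e2, ← e3, e1] at this
        rw [hrp, e2, ← e3]
        linarith
    have hr0 : (0 : ℝ) ≤ (r : ℝ) / 2 ^ (m + 1) := by positivity
    have hr1 : ((r : ℝ) + 1) / 2 ^ (m + 1) ≤ 1 := by
      have h := bisect_upper_anti R (Nat.zero_le (m + 1))
      dsimp only at h
      rw [pow_zero, div_one, show bisect R 0 = 0 from rfl, Nat.cast_zero, zero_add] at h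
      exact h
    have hrr : (r : ℝ) / 2 ^ (m + 1) ≤ ((r : ℝ) + 1) / 2 ^ (m + 1) := by gcongr; linarith
    -- the new summands
    have hnew : ∫ x in ((r : ℝ) / 2 ^ (m + 1))..((r + 1) / 2 ^ (m + 1)),
        ∑ n ∈ Finset.Ico (4 ^ m) (4 ^ (m + 1)), D n x ≤ 1 / 2 * (1 / 4 ^ m) := by
      rw [intervalIntegral.integral_finsetSum fun n _ => (hcont n).intervalIntegrable _ _]
      have hterm : ∀ n ∈ Finset.Ico (4 ^ m) (4 ^ (m + 1)),
          ∫ x in ((r : ℝ) / 2 ^ (m + 1))..((r + 1) / 2 ^ (m + 1)), D n x ≤ 1 / (6 * (4 ^ m) ^ 2) := by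
        intro n hn
        have hn' : (4 : ℝ) ^ m ≤ n + 1 := by
          have : 4 ^ m ≤ n := (Finset.mem_Ico.1 hn).1
          have : ((4 ^ m : ℕ) : ℝ) ≤ n := by exact_mod_cast this
          push_cast at this; linarith
        refine (intervalIntegral.integral_mono_interval hr0 hrr hr1
          (Filter.Eventually.of_forall (hpos n)) ((hcont n).intervalIntegrable _ _)).trans ?_
        refine (hint n).trans ?_
        gcongr
      -- There are 3 · 4^m new summands, each at most 1 / (6 · 16^m).
      refine (Finset.sum_le_card_nsmul _ _ _ hterm).trans ?_
      rw [Nat.card_Ico, nsmul_eq_mul, Nat.cast_sub (Nat.pow_le_pow_right (by norm_num) (by omega))]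
      push_cast
      rw [pow_succ]
      apply le_of_eq
      field_simp
      ring
    have hsum : ∫ x in ((r : ℝ) / 2 ^ (m + 1))..((r + 1) / 2 ^ (m + 1)),
        ∑ n ∈ Finset.range (4 ^ (m + 1)), D n x =
        (∫ x in ((r : ℝ) / 2 ^ (m + 1))..((r + 1) / 2 ^ (m + 1)), F x) +
        ∫ x in ((r : ℝ) / 2 ^ (m + 1))..((r + 1) / 2 ^ (m + 1)),
          ∑ n ∈ Finset.Ico (4 ^ m) (4 ^ (m + 1)), D n x := by
      rw [← intervalIntegral.integral_add (hFi _ _) ((continuous_finsetSum _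
        fun n _ => hcont n).intervalIntegrable _ _)]
      refine intervalIntegral.integral_congr fun x _ => ?_
      exact (Finset.sum_range_add_sum_Ico (fun n => D n x)
        (Nat.pow_le_pow_right (by norm_num) (by omega))).symm
    rw [hsum]
    have e4 : (2 : ℝ) ^ m * (1 / 4 ^ m) = 1 / 2 ^ m := by
      rw [show (4 : ℝ) = 2 * 2 by norm_num, mul_pow]; field_simp
    have e5 : (4 : ℝ) / 2 ^ (m + 1) = 2 * (1 / 2 ^ m) := by rw [pow_succ]; field_simp; norm_num
    have e6 : (4 : ℝ) / 2 ^ m = 4 * (1 / 2 ^ m) := by ring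
    rw [e5]
    rw [e6] at ih
    have h5 := mul_le_mul_of_nonneg_left hhalf h2.le
    have h6 := mul_le_mul_of_nonneg_left hnew h2.le
    rw [mul_add] at h5
    have e7 : ∀ z : ℝ, 2 ^ (m + 1) * z = 2 ^ m * (2 * z) := fun z => by ring
    rw [e7]
    linarith

open MeasureTheory in
theorem exists_computable_sum_le {D : ℕ → ℝ → ℝ} (hcont : ∀ n, Continuous (D n))
    (hpos : ∀ n x, 0 ≤ D n x)
    (hint : ∀ n, ∫ x in (0 : ℝ)..1, D n x ≤ 1 / (6 * ((n : ℝ) + 1) ^ 2)) {R : ℕ → ℕ → ℕ}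
    (hR : Computable₂ R)
    (hscore : ∀ m p q, R m q ≤ R m p →
      ∫ x in ((p : ℝ) / 2 ^ (m + 1))..((p + 1) / 2 ^ (m + 1)), ∑ n ∈ Finset.range (4 ^ m), D n x ≤
      (∫ x in ((q : ℝ) / 2 ^ (m + 1))..((q + 1) / 2 ^ (m + 1)), ∑ n ∈ Finset.range (4 ^ m), D n x)
        + 1 / 4 ^ m) :
    ∃ x ∈ Set.Icc (0 : ℝ) 1, IsComputableReal x ∧ ∀ K, ∑ n ∈ Finset.range K, D n x ≤ 5 := by
  have hx := (bisect_lower_mono R).ciSup_mem_iInter_Icc_of_antitone (bisect_upper_anti R)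
    fun m => by dsimp only; gcongr; linarith
  set x := ⨆ m, (bisect R m : ℝ) / 2 ^ m
  rw [Set.mem_iInter] at hx
  have hlen : ∀ m, ((bisect R m : ℝ) + 1) / 2 ^ m = (bisect R m : ℝ) / 2 ^ m + (1 / 2) ^ m := by
    intro m; rw [add_div, one_div_pow]
  refine ⟨x, by simpa [bisect] using hx 0, ⟨fun m => (bisect R m : ℤ), fun m => 2 ^ m,
    Primrec.int_natCast.to_comp.comp (computable_bisect hR),
    (Primrec.nat_pow.comp (Primrec.const 2) Primrec.id).to_comp, fun m => ⟨by positivity, ?_⟩⟩, ?_⟩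
  · have h := hx m
    rw [Set.mem_Icc, hlen] at h
    push_cast
    rw [abs_le]
    constructor <;> linarith [h.1, h.2, pow_pos (one_half_pos (α := ℝ)) m]
  intro K
  have hFc : ∀ K, Continuous fun x => ∑ n ∈ Finset.range K, D n x := fun K =>
    continuous_finsetSum _ fun n _ => hcont n
  -- The mean over the m-th interval is below 5, so the partial sum cannot exceed 5 throughout it;
  -- such points converge to x, and continuity transfers the bound.
  have hnear : ∀ m, K ≤ 4 ^ m → ∃ y ∈ Set.Icc ((bisect R m : ℝ) / 2 ^ m) ((bisect R m + 1) / 2 ^ m),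
      ∑ n ∈ Finset.range K, D n y ≤ 5 := by
    intro m hm
    by_contra! hcon
    have hlt : (bisect R m : ℝ) / 2 ^ m ≤ ((bisect R m : ℝ) + 1) / 2 ^ m := by gcongr; linarith
    have h1 := integral_bisect_le hcont hpos hint hscore m
    have h2 : ∫ _ in ((bisect R m : ℝ) / 2 ^ m)..((bisect R m + 1) / 2 ^ m), (5 : ℝ) ≤
        ∫ x in ((bisect R m : ℝ) / 2 ^ m)..((bisect R m + 1) / 2 ^ m),
          ∑ n ∈ Finset.range (4 ^ m), D n x := by
      refine intervalIntegral.integral_mono_on hlt (by simp) ((hFc _).intervalIntegrable _ _)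
        fun y hy => (hcon y hy).le.trans ?_
      exact Finset.sum_le_sum_of_subset_of_nonneg (Finset.range_mono hm) fun n _ _ => hpos n y
    rw [intervalIntegral.integral_const, hlen, add_sub_cancel_left, smul_eq_mul] at h2
    have h3 := mul_le_mul_of_nonneg_left h2 (pow_pos (two_pos (α := ℝ)) m).le
    rw [← mul_assoc, ← mul_pow, mul_one_div_cancel two_ne_zero, one_pow, one_mul, ← hlen] at h3
    have : (0 : ℝ) < 4 / 2 ^ m := by positivity
    linarith
  choose! y hy hy5 using hnear
  have hev : ∀ᶠ m in Filter.atTop, K ≤ 4 ^ m :=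
    (tendsto_pow_atTop_atTop_of_one_lt (by norm_num)).eventually_ge_atTop K
  have hlim : Filter.Tendsto y Filter.atTop (nhds x) := by
    rw [tendsto_iff_dist_tendsto_zero]
    refine squeeze_zero' (Filter.Eventually.of_forall fun m => dist_nonneg) ?_
      (tendsto_pow_atTop_nhds_zero_of_lt_one (r := (1 / 2 : ℝ)) (by norm_num) (by norm_num))
    filter_upwards [hev] with m hm
    refine (Real.dist_le_of_mem_Icc (hy m hm) (hx m)).trans (le_of_eq ?_)
    rw [hlen]; ring
  exact le_of_tendsto (((hFc K).tendsto x).comp hlim) (hev.mono fun m hm => hy5 m hm)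

/-! ### Integer scores approximating the integrals -/

theorem integral_fractParabola_nat {T : ℕ} (hT : T ≠ 0) (c p : ℕ) :
    ((parabolaNat T (c * (p + 1)) - parabolaNat T (c * p) : ℕ) : ℝ) =
      6 * (T : ℝ) ^ 3 * (c * ∫ x in ((p : ℝ) / T)..((p + 1) / T), fractParabola (c * x)) := by
  have hle : (p : ℝ) / T ≤ (p + 1) / T := by gcongr; linarith
  have h : (parabolaNat T (c * (p + 1)) : ℝ) - parabolaNat T (c * p) =
      6 * (T : ℝ) ^ 3 * (c * ∫ x in ((p : ℝ) / T)..((p + 1) / T), fractParabola (c * x)) := by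
    rw [parabolaNat_cast hT, parabolaNat_cast hT, integral_fractParabola_mul]
    push_cast
    rw [mul_div_assoc, mul_div_assoc, mul_sub]
  have h0 : 0 ≤ ∫ x in ((p : ℝ) / T)..((p + 1) / T), fractParabola (c * x) :=
    intervalIntegral.integral_nonneg hle fun x _ => fractParabola_nonneg _
  rw [← h, Nat.cast_sub]
  rw [← Nat.cast_le (α := ℝ), ← sub_nonneg, h]
  positivity

/-- Integer approximation of the integral of `fractParabola (c x) / W` over `[p / T, (p + 1) / T]`,
scaled by `6 S T ^ 3`. -/
def parabolaScore (S T W p c : ℕ) : ℕ :=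
  S * (parabolaNat T (c * (p + 1)) - parabolaNat T (c * p)) / (c * W)

theorem parabolaScore_bounds {T W : ℕ} (hT : T ≠ 0) (hW : W ≠ 0) (S p c : ℕ) :
    (parabolaScore S T W p c : ℝ) ≤ 6 * (T : ℝ) ^ 3 * S *
        ((∫ x in ((p : ℝ) / T)..((p + 1) / T), fractParabola (c * x)) / W) ∧
      6 * (T : ℝ) ^ 3 * S * ((∫ x in ((p : ℝ) / T)..((p + 1) / T), fractParabola (c * x)) / W) ≤
        parabolaScore S T W p c + 1 := by
  rcases Nat.eq_zero_or_pos c with rfl | hc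
  -- For c = 0 the division by zero returns 0, which is the correct integral.
  · simp [parabolaScore, fractParabola_zero]
  have hc' : (c : ℝ) ≠ 0 := by positivity
  have hW' : (W : ℝ) ≠ 0 := by exact_mod_cast hW
  have key : 6 * (T : ℝ) ^ 3 * S *
        ((∫ x in ((p : ℝ) / T)..((p + 1) / T), fractParabola (c * x)) / W) =
      ((S * (parabolaNat T (c * (p + 1)) - parabolaNat T (c * p)) : ℕ) : ℝ) / ((c * W : ℕ) : ℝ) := by
    rw [Nat.cast_mul, integral_fractParabola_nat hT]
    push_cast
    field_simp
  rw [key]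
  refine ⟨Nat.cast_div_le, ?_⟩
  rw [parabolaScore, ← Nat.floor_div_eq_div (K := ℝ)]
  exact (Nat.lt_floor_add_one _).le

/-! ### The stages and their scores -/

/-- `N_n = (n + 1) ^ 2` terms are inspected at stage `n`. -/
def stageLength (n : ℕ) : ℕ := (n + 1) ^ 2

/-- Number of the pairs of indices inspected before stage `K`. -/
def pairCount (K : ℕ) : ℕ := ∑ n ∈ Finset.range K, stageLength n * stageLength n

/-- Absolute difference of two terms of the sequence treated at stage `n`. -/
def stageDiff (a : ℕ → ℕ → ℤ) (n j k : ℕ) : ℕ := (a n.unpair.1 j - a n.unpair.1 k).natAbs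

/-- The score of the `p`-th dyadic interval of level `m + 1`. -/
def stageScore (a : ℕ → ℕ → ℤ) (m p : ℕ) : ℕ :=
  ∑ n ∈ Finset.range (4 ^ m), ∑ j ∈ Finset.range (stageLength n), ∑ k ∈ Finset.range (stageLength n),
    parabolaScore (pairCount (4 ^ m)) (2 ^ (m + 1)) (stageLength n ^ 2) p (stageDiff a n j k)

/-- Normalized squared diaphony at stage `n`, as a function of the multiplier. -/
noncomputable def stageDiaphony (a : ℕ → ℕ → ℤ) (n : ℕ) (x : ℝ) : ℝ :=
  diaphony (fun j => a n.unpair.1 j * x) (stageLength n) / (stageLength n : ℝ) ^ 2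

theorem stageDiaphony_eq (a : ℕ → ℕ → ℤ) (n : ℕ) (x : ℝ) :
    stageDiaphony a n x = ∑ j ∈ Finset.range (stageLength n), ∑ k ∈ Finset.range (stageLength n),
      (1 / 6 - fractParabola (stageDiff a n j k * x)) / (stageLength n : ℝ) ^ 2 := by
  simp only [stageDiaphony, diaphony, Finset.sum_div]
  refine Finset.sum_congr rfl fun j _ => Finset.sum_congr rfl fun k _ => ?_
  rw [stageDiff, ← fractParabola_intCast_mul, ← sub_mul, ← Int.cast_sub]

theorem stageLength_pos (n : ℕ) : 0 < stageLength n := pow_pos n.succ_pos 2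

theorem continuous_fractParabola_mul (c : ℝ) : Continuous fun x => fractParabola (c * x) :=
  fractParabola_continuous.comp (continuous_const_mul c)

theorem continuous_stageDiaphony (a : ℕ → ℕ → ℤ) (n : ℕ) : Continuous (stageDiaphony a n) := by
  have h : stageDiaphony a n = fun x => ∑ j ∈ Finset.range (stageLength n),
      ∑ k ∈ Finset.range (stageLength n),
        (1 / 6 - fractParabola (stageDiff a n j k * x)) / (stageLength n : ℝ) ^ 2 :=
    funext (stageDiaphony_eq a n)
  rw [h]
  exact continuous_finsetSum _ fun j _ => continuous_finsetSum _ fun k _ =>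
    (continuous_const.sub (continuous_fractParabola_mul _)).div_const _

theorem integral_stageDiaphony (a : ℕ → ℕ → ℤ) (n : ℕ) (s t : ℝ) :
    ∫ x in s..t, stageDiaphony a n x = ∑ j ∈ Finset.range (stageLength n),
      ∑ k ∈ Finset.range (stageLength n), ((t - s) / 6 / (stageLength n : ℝ) ^ 2 -
        (∫ x in s..t, fractParabola (stageDiff a n j k * x)) / (stageLength n : ℝ) ^ 2) := by
  simp only [stageDiaphony_eq]
  have hc : ∀ j k, Continuous fun x =>
      (1 / 6 - fractParabola (stageDiff a n j k * x)) / (stageLength n : ℝ) ^ 2 := fun j k =>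
    (continuous_const.sub (continuous_fractParabola_mul _)).div_const _
  rw [intervalIntegral.integral_finsetSum fun j _ =>
    (continuous_finsetSum _ fun k _ => hc j k).intervalIntegrable _ _]
  refine Finset.sum_congr rfl fun j _ => ?_
  rw [intervalIntegral.integral_finsetSum fun k _ => (hc j k).intervalIntegrable _ _]
  refine Finset.sum_congr rfl fun k _ => ?_
  rw [intervalIntegral.integral_div, intervalIntegral.integral_sub (by simp)
    ((continuous_fractParabola_mul _).intervalIntegrable _ _), intervalIntegral.integral_const,
    smul_eq_mul]
  ring

/-- Only the diagonal j = k survives: injectivity makes every other difference nonzero, and then the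
parabola has mean exactly 1/6. -/
theorem integral_unit_stageDiaphony {a : ℕ → ℕ → ℤ} (hinj : ∀ i, Function.Injective (a i)) (n : ℕ) :
    ∫ x in (0 : ℝ)..1, stageDiaphony a n x = 1 / (6 * ((n : ℝ) + 1) ^ 2) := by
  have hpos : (stageLength n : ℝ) ≠ 0 := by exact_mod_cast (stageLength_pos n).ne'
  have hterm : ∀ j k, ((1 - 0 : ℝ) / 6 / (stageLength n : ℝ) ^ 2 -
      (∫ x in (0 : ℝ)..1, fractParabola (stageDiff a n j k * x)) / (stageLength n : ℝ) ^ 2) =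
      if j = k then 1 / 6 / (stageLength n : ℝ) ^ 2 else 0 := by
    intro j k
    split_ifs with h
    · subst h
      simp [stageDiff, fractParabola_zero]
    · have hne : stageDiff a n j k ≠ 0 := by
        rw [stageDiff, Int.natAbs_ne_zero, sub_ne_zero]
        exact (hinj _).ne h
      rw [integral_unit_fractParabola_mul hne]
      ring
  rw [integral_stageDiaphony]
  simp only [hterm, Finset.sum_ite_eq]
  rw [Finset.sum_ite_mem, Finset.inter_self, Finset.sum_const, Finset.card_range, nsmul_eq_mul]
  have e : ((n : ℝ) + 1) ^ 2 = stageLength n := by simp [stageLength]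
  rw [e]
  field_simp

/-- The integral of the diaphonies is a constant independent of p minus `V p`, so a larger score
means a smaller diaphony. The score is 6T³S · `V p` with S terms each rounded down by at most 1,
hence `V` is known up to 1/(6T³). -/
theorem integral_le_of_stageScore_le (a : ℕ → ℕ → ℤ) (m p q : ℕ)
    (h : stageScore a m q ≤ stageScore a m p) :
    ∫ x in ((p : ℝ) / 2 ^ (m + 1))..((p + 1) / 2 ^ (m + 1)),
        ∑ n ∈ Finset.range (4 ^ m), stageDiaphony a n x ≤
      (∫ x in ((q : ℝ) / 2 ^ (m + 1))..((q + 1) / 2 ^ (m + 1)),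
        ∑ n ∈ Finset.range (4 ^ m), stageDiaphony a n x) + 1 / 4 ^ m := by
  set S := pairCount (4 ^ m) with hS
  set T := 2 ^ (m + 1) with hT
  have hT0 : T ≠ 0 := by positivity
  have hTc : (2 : ℝ) ^ (m + 1) = (T : ℝ) := by rw [hT]; norm_cast
  set V : ℕ → ℝ := fun p => ∑ n ∈ Finset.range (4 ^ m), ∑ j ∈ Finset.range (stageLength n),
    ∑ k ∈ Finset.range (stageLength n),
      (∫ x in ((p : ℝ) / T)..((p + 1) / T), fractParabola (stageDiff a n j k * x)) /
        (stageLength n : ℝ) ^ 2 with hV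
  have hint : ∀ p : ℕ, ∫ x in ((p : ℝ) / T)..((p + 1) / T),
      ∑ n ∈ Finset.range (4 ^ m), stageDiaphony a n x =
      (∑ n ∈ Finset.range (4 ^ m), ∑ j ∈ Finset.range (stageLength n),
        ∑ k ∈ Finset.range (stageLength n), 1 / (T : ℝ) / 6 / (stageLength n : ℝ) ^ 2) - V p := by
    intro p
    rw [intervalIntegral.integral_finsetSum fun n _ =>
      (continuous_stageDiaphony a n).intervalIntegrable _ _]
    simp only [integral_stageDiaphony, hV, ← Finset.sum_sub_distrib, ← sub_div, add_sub_cancel_left]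
  have hW : ∀ n, stageLength n ^ 2 ≠ 0 := fun n => (pow_pos (stageLength_pos n) 2).ne'
  have hlow : ∀ p : ℕ, (stageScore a m p : ℝ) ≤ 6 * (T : ℝ) ^ 3 * S * V p := by
    intro p
    simp only [stageScore, hV, Nat.cast_sum, Finset.mul_sum]
    refine Finset.sum_le_sum fun n _ => Finset.sum_le_sum fun j _ => Finset.sum_le_sum fun k _ => ?_
    simpa using (parabolaScore_bounds hT0 (hW n) S p (stageDiff a n j k)).1
  have hupp : ∀ p : ℕ, 6 * (T : ℝ) ^ 3 * S * V p ≤ stageScore a m p + S := by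
    intro p
    have hS' : (S : ℝ) = ∑ n ∈ Finset.range (4 ^ m), ∑ j ∈ Finset.range (stageLength n),
        ∑ k ∈ Finset.range (stageLength n), (1 : ℝ) := by
      simp [hS, pairCount]
    rw [hS']
    simp only [stageScore, Nat.cast_sum, ← Finset.sum_add_distrib]
    rw [← hS']
    simp only [hV, Finset.mul_sum]
    refine Finset.sum_le_sum fun n _ => Finset.sum_le_sum fun j _ => Finset.sum_le_sum fun k _ => ?_
    simpa using (parabolaScore_bounds hT0 (hW n) S p (stageDiff a n j k)).2
  have hSpos : (0 : ℝ) < S := by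
    have : 0 < S := Finset.sum_pos (fun n _ => Nat.mul_pos (stageLength_pos n) (stageLength_pos n))
      ⟨0, by simp⟩
    exact_mod_cast this
  have hTpos : (0 : ℝ) < T := by positivity
  have hmain : V q ≤ V p + 1 / (6 * (T : ℝ) ^ 3) := by
    have h' : (stageScore a m q : ℝ) ≤ stageScore a m p := by exact_mod_cast h
    have h1 := (hupp q).trans ((add_le_add_left h' _).trans (add_le_add_left (hlow p) _))
    have h2 : 6 * (T : ℝ) ^ 3 * S * (V p + 1 / (6 * (T : ℝ) ^ 3)) = 6 * (T : ℝ) ^ 3 * S * V p + S := by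
      field_simp
    rw [← h2] at h1
    exact le_of_mul_le_mul_left h1 (by positivity)
  have hsmall : 1 / (6 * (T : ℝ) ^ 3) ≤ 1 / 4 ^ m := by
    refine one_div_le_one_div_of_le (by positivity) ?_
    have h1 : (1 : ℝ) ≤ 2 ^ m := one_le_pow₀ (by norm_num)
    have h2 : (T : ℝ) = 2 * 2 ^ m := by rw [← hTc]; ring
    have h3 : (4 : ℝ) ^ m = 2 ^ m * 2 ^ m := by rw [← mul_pow]; norm_num
    rw [h2, h3]
    have h4 : (2 : ℝ) ^ m * 2 ^ m * 1 ≤ 2 ^ m * 2 ^ m * 2 ^ m := by gcongr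
    nlinarith [h4]
  rw [hTc, hint, hint]
  linarith

/-! ### Computability of the scores -/

theorem primrec_parabolaNat : Primrec₂ parabolaNat := by
  have hT : Primrec fun z : ℕ × ℕ => z.1 := Primrec.fst
  have hs : Primrec fun z : ℕ × ℕ => z.2 := Primrec.snd
  have hmod := Primrec.nat_mod.comp hs hT
  exact Primrec.nat_add.comp
    (Primrec.nat_mul.comp (Primrec.nat_pow.comp hT (Primrec.const 3)) (Primrec.nat_div.comp hs hT))
    (Primrec.nat_sub.comp
      (Primrec.nat_mul.comp (Primrec.nat_mul.comp (Primrec.const 3)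
        (Primrec.nat_pow.comp hmod (Primrec.const 2))) hT)
      (Primrec.nat_mul.comp (Primrec.const 2) (Primrec.nat_pow.comp hmod (Primrec.const 3))))

theorem computable_parabolaScore {α : Type*} [Primcodable α] {S T W p c : α → ℕ}
    (hS : Computable S) (hT : Computable T) (hW : Computable W) (hp : Computable p)
    (hc : Computable c) : Computable fun x => parabolaScore (S x) (T x) (W x) (p x) (c x) :=
  have hmul := Primrec.nat_mul.to_comp
  have hpar := primrec_parabolaNat.to_comp
  Primrec.nat_div.to_comp.comp
    (hmul.comp hS (Primrec.nat_sub.to_comp.comp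
      (hpar.comp hT (hmul.comp hc (Computable.succ.comp hp))) (hpar.comp hT (hmul.comp hc hp))))
    (hmul.comp hc hW)

theorem computable_stageLength : Computable stageLength :=
  (Primrec.nat_pow.comp Primrec.succ (Primrec.const 2)).to_comp

theorem computable_pairCount : Computable pairCount :=
  Computable.nat_sum_range Computable.id
    ((Primrec.nat_mul.to_comp.comp computable_stageLength computable_stageLength).comp Computable.snd)

theorem computable_stageDiff {a : ℕ → ℕ → ℤ} (ha : Computable₂ a) {α : Type*} [Primcodable α]
    {n j k : α → ℕ} (hn : Computable n) (hj : Computable j) (hk : Computable k) :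
    Computable fun x => stageDiff a (n x) (j x) (k x) :=
  have hi := Computable.fst.comp (Computable.unpair.comp hn)
  Primrec.int_natAbs_sub.to_comp.comp (ha.comp hi hj) (ha.comp hi hk)

theorem computable_stageScore {a : ℕ → ℕ → ℤ} (ha : Computable₂ a) :
    Computable₂ (stageScore a) := by
  have hpow := Primrec.nat_pow.to_comp
  have hn : Computable fun z : (((ℕ × ℕ) × ℕ) × ℕ) × ℕ => z.1.1.2 :=
    Computable.snd.comp (Computable.fst.comp Computable.fst)
  have hm : Computable fun z : (((ℕ × ℕ) × ℕ) × ℕ) × ℕ => z.1.1.1.1 :=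
    Computable.fst.comp (Computable.fst.comp (Computable.fst.comp Computable.fst))
  have hp : Computable fun z : (((ℕ × ℕ) × ℕ) × ℕ) × ℕ => z.1.1.1.2 :=
    Computable.snd.comp (Computable.fst.comp (Computable.fst.comp Computable.fst))
  have hj : Computable fun z : (((ℕ × ℕ) × ℕ) × ℕ) × ℕ => z.1.2 :=
    Computable.snd.comp Computable.fst
  have hterm : Computable fun z : (((ℕ × ℕ) × ℕ) × ℕ) × ℕ =>
      parabolaScore (pairCount (4 ^ z.1.1.1.1)) (2 ^ (z.1.1.1.1 + 1)) (stageLength z.1.1.2 ^ 2)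
        z.1.1.1.2 (stageDiff a z.1.1.2 z.1.2 z.2) :=
    computable_parabolaScore
      (computable_pairCount.comp (hpow.comp (Computable.const 4) hm))
      (hpow.comp (Computable.const 2) (Computable.succ.comp hm))
      (hpow.comp (computable_stageLength.comp hn) (Computable.const 2)) hp
      (computable_stageDiff ha hn hj Computable.snd)
  have hk := Computable.nat_sum_range (α := ((ℕ × ℕ) × ℕ) × ℕ) (b := fun z => stageLength z.1.2)
    (computable_stageLength.comp (Computable.snd.comp Computable.fst)) hterm.to₂
  have hj' := Computable.nat_sum_range (α := (ℕ × ℕ) × ℕ) (b := fun z => stageLength z.2)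
    (computable_stageLength.comp Computable.snd) hk.to₂
  exact Computable.nat_sum_range (α := ℕ × ℕ) (b := fun z => 4 ^ z.1)
    (hpow.comp (Computable.const 4) Computable.fst) hj'.to₂

/-! ### Growth of the inspected lengths and conclusion -/

open Filter in
theorem tendsto_stageLength_ratio (i : ℕ) :
    Tendsto (fun k => (stageLength (Nat.pair i (k + 1)) : ℝ) / (stageLength (Nat.pair i k) : ℝ))
      atTop (nhds 1) := by
  have h0 : Tendsto (fun k : ℕ => 1 + 3 / (k : ℝ)) atTop (nhds 1) := by
    simpa using (tendsto_const_div_atTop_nhds_zero_nat (3 : ℝ)).const_add 1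
  have h1 : Tendsto (fun k : ℕ => (((k : ℝ) + 1) ^ 2 + i + 1) / ((k : ℝ) ^ 2 + i + 1)) atTop
      (nhds 1) := by
    refine tendsto_of_tendsto_of_tendsto_of_le_of_le' tendsto_const_nhds h0 ?_ ?_
    · filter_upwards with k
      rw [one_le_div (by positivity)]
      nlinarith [(k.cast_nonneg : (0 : ℝ) ≤ k)]
    · filter_upwards [eventually_ge_atTop 1] with k hk
      have hk' : (1 : ℝ) ≤ k := by exact_mod_cast hk
      have hi : (0 : ℝ) ≤ i := i.cast_nonneg
      have h3 : ((k : ℝ) + 1) ^ 2 + i + 1 ≤ (1 + 3 / (k : ℝ)) * ((k : ℝ) ^ 2 + i + 1) := by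
        have e : (1 + 3 / (k : ℝ)) * ((k : ℝ) ^ 2 + i + 1) =
            (k : ℝ) ^ 2 + i + 1 + 3 * k + 3 * (i + 1) / k := by field_simp; ring
        have : 0 ≤ 3 * ((i : ℝ) + 1) / k := by positivity
        rw [e]; nlinarith
      rwa [div_le_iff₀ (by positivity)]
  have h2 := h1.pow 2
  rw [one_pow] at h2
  refine h2.congr' ?_
  filter_upwards [eventually_gt_atTop i] with k hk
  -- For k > i the pairing is k² + i, so the length is (k² + i + 1)².
  rw [stageLength, stageLength, Nat.pair, Nat.pair, if_pos hk, if_pos (hk.trans k.lt_succ_self),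
    div_pow]
  push_cast
  ring

theorem mainTheorem2 (a : ℕ → ℕ → ℤ) (ha : Computable₂ a)
    (hinj : ∀ i : ℕ, Function.Injective (a i)) :
    ∃ x : ℝ, x ∈ Set.Icc (0 : ℝ) 1 ∧ IsComputableReal x ∧
      ∀ i : ℕ, UniformlyDistributedModOne (fun j : ℕ => (a i j : ℝ) * x) := by
  have hpos : ∀ n x, 0 ≤ stageDiaphony a n x := fun n x =>
    div_nonneg (diaphony_nonneg _ _) (by positivity)
  obtain ⟨x, hx, hcomp, hsum⟩ := exists_computable_sum_le (continuous_stageDiaphony a) hpos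
    (fun n => (integral_unit_stageDiaphony hinj n).le) (computable_stageScore ha)
    (integral_le_of_stageScore_le a)
  have hlim := (summable_of_sum_range_le (fun n => hpos n x) hsum).tendsto_atTop_zero
  refine ⟨x, hx, hcomp, fun i => ?_⟩
  have hpair : Filter.Tendsto (fun k => Nat.pair i k) Filter.atTop Filter.atTop :=
    Filter.tendsto_atTop_mono (fun k => Nat.right_le_pair i k) Filter.tendsto_id
  have hpred : ∀ k, stageLength (Nat.pair i k) - 1 + 1 = stageLength (Nat.pair i k) := fun k =>
    Nat.sub_add_cancel (stageLength_pos _)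
  have hpred' : ∀ k, ((stageLength (Nat.pair i k) - 1 : ℕ) : ℝ) + 1 =
      stageLength (Nat.pair i k) := fun k => by rw [← Nat.cast_add_one, hpred]
  -- The shift by 1 matches the criterion, which counts the first `c k + 1` terms.
  refine uniformlyDistributed_of_tendsto_diaphony _ (fun k => stageLength (Nat.pair i k) - 1) ?_ ?_ ?_
  · refine Filter.tendsto_atTop_mono (fun k => ?_) hpair
    rw [stageLength]
    exact Nat.le_sub_of_add_le (Nat.le_self_pow two_ne_zero _)
  · simp only [hpred]
    exact tendsto_stageLength_ratio i
  · simp only [hpred, hpred']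
    refine (hlim.comp hpair).congr fun k => ?_
    simp [stageDiaphony]
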